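/- Let $\mathcal A,\mathcal B$ be bicategories and $U:\mathcal A\to\mathcal B$ a pseudofunctor. Definitions. For an object $X$ of a bicategory $\mathcal C$, the pseudoslice $\mathcal C/X$ has as 0-cells the 1-cells $f:B\to X$, as 1-cells $f\to g$ the pairs $(k,\kappa)$ with $\kappa: g k\cong f$ an invertible 2-cell, and as 2-cells $(k,\kappa)\Rightarrow(l,\lambda)$ the 2-cells $\phi:k\Rightarrow l$ with $\lambda\cdot(g\phi)=\kappa$; $U$ induces pseudofunctors $U_A:\mathcal A/A\to\mathcal B/U(A)$. A left biadjoint of a pseudofunctor $R:\mathcal C\to\mathcal D$ is a pseudofunctor $L:\mathcal D\to\mathcal C$ with a pseudonatural transformation $\eta:1\Rightarrow RL$ (the unit) such that $w\mapsto R(w)\eta_d$ is an equivalence of categories $\mathcal C(Ld,c)\simeq\mathcal D(d,Rc)$ for all $d,c$. $U$ is a local right biadjoint if every $U_A$ has a left biadjoint $L_A$; the unit of $L_A$ at $f:B\to U(A)$ is then a pair $(h^A_f,\eta^A_f)$ with $h^A_f:B\to U(A_f)$, $L_A(f):A_f\to A$ and $\eta^A_f:U(L_A(f))h^A_f\cong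 f$, and a 1-cell $h^A_f$ arising in this way (for some $A$, some left biadjoint $L_A$ of $U_A$ and some $f$) is called a local unit. A filler of an invertible 2-cell $\alpha:U(u)f\cong U(v)n$, where $n:B\to U(A)$, $f:B\to U(A_1)$, $u:A_1\to A_2$, $v:A\to A_2$, is a triple $(w,\nu,\omega)$ with $w:A\to A_1$ and invertible 2-cells $\nu:f\cong U(w)n$, $\omega:uw\cong v$ such that the pasting of $\nu$ and $U(\omega)$ is $\alpha$. A 1-cell $n:B\to U(A)$ is $U$-generic if every such $\alpha$ has a filler, any two fillers of $\alpha$ are related by a unique invertible 2-cell $w\cong w'$ compatible with the $\nu$'s and $\omega$'s, and for every $\phi:f_1\Rightarrow f_2$ with $\alpha_2\cdot(U(u)\phi)=\alpha_1$ and all fillers $(w_i,\nu_i,\omega_i)$ of $\alpha_i$ there is a unique 2-cell $\sigma:w_1\Rightarrow w_2$ with $\omega_2\cdot(u\sigma)=\omega_1$ and $(U(\sigma)n)\cdot\nu_1=\nu_2\cdot\phi$. A generic factorization of $f:B\to U(A)$ is an invertible 2-cell $\alpha_f:U(u_f)n_f\cong f$ with $u_f:A_f\to A$ and $n_f:B\to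 U(A_f)$ $U$-generic. $U$ is bistable if every $f:B\to U(A)$ has a generic factorization $(A_f,n_f,u_f,\alpha_f)$ such that for every generic factorization $(A',n,u,\alpha)$ of $f$ there are an equivalence $e:A'\simeq A_f$ in $\mathcal A$ and invertible 2-cells $\nu:U(e)n\cong n_f$, $\omega:u_fe\cong u$ whose pasting with $\alpha_f$ is $\alpha$, the triple $(e,\nu,\omega)$ being unique up to a unique compatible invertible 2-cell. Theorem. (1) $U$ is bistable if and only if it is a local right biadjoint. (2) If $U$ is bistable, then a 1-cell $n:B\to U(A)$ is $U$-generic if and only if it is a local unit. (3) For any choice of left biadjoints $L_A$ of all the $U_A$, every unit component $h^A_f$ is $U$-generic, and a 1-cell $n:B\to U(A)$ is $U$-generic if and only if $L_A(n):A_n\to A$ is an equivalence in $\mathcal A$. (4) For every object $A$ and every choice of generic factorizations $(A_f,n_f,u_f,\alpha_f)$ of all 1-cells $f:B\to U(A)$ (all $B$), $U_A$ has a left biadjoint $L_A$ with $L_A(f)=u_f$ and unit $(n_f,\alpha_f)$ at every $f$. -/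

import Mathlib

open CategoryTheory Bicategory

universe w₁ w₂ v₁ v₂ u₁ u₂

namespace TwoDimStability

section Slice

variable {B : Type u₁} [Bicategory.{w₁, v₁} B]

/-- A 1-cell of a bicategory is an equivalence if it underlies an (adjoint) equivalence. -/
def IsEquivalence₁ {a b : B} (e : a ⟶ b) : Prop :=
  ∃ E : Bicategory.Equivalence a b, E.hom = e

/-- The 0-cells of the pseudoslice `B/x`: the 1-cells of `B` with codomain `x`. -/
structure PseudoSlice (x : B) where
  /-- the domain -/
  left : B
  /-- the structure 1-cell -/
  hom : left ⟶ x

namespace PseudoSlice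

variable {x : B}

/-- The 1-cells `(left, iso)` of the pseudoslice: triangles filled by an invertible 2-cell. -/
structure Hom₁ (f g : PseudoSlice x) where
  /-- the underlying 1-cell -/
  left : f.left ⟶ g.left
  /-- the invertible 2-cell filling the triangle -/
  iso : left ≫ g.hom ≅ f.hom

instance : CategoryStruct (PseudoSlice x) where
  Hom f g := Hom₁ f g
  id f := ⟨𝟙 f.left, λ_ f.hom⟩
  comp {_ _ h} k l :=
    ⟨k.left ≫ l.left, α_ k.left l.left h.hom ≪≫ whiskerLeftIso k.left l.iso ≪≫ k.iso⟩

/-- The 2-cells `(u, α) ⟶ (u', α')` of the pseudoslice: 2-cells `u ⟶ u'` of `B` compatible with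
the triangles. -/
@[ext]
structure Hom₂ {f g : PseudoSlice x} (k l : f ⟶ g) where
  /-- the underlying 2-cell -/
  left : k.left ⟶ l.left
  w : left ▷ g.hom ≫ l.iso.hom = k.iso.hom

instance homCat (f g : PseudoSlice x) : Category (f ⟶ g) where
  Hom k l := Hom₂ k l
  id k := ⟨𝟙 k.left, by simp⟩
  comp φ ψ := ⟨φ.left ≫ ψ.left, by simp [φ.w, ψ.w]⟩
  id_comp φ := Hom₂.ext (Category.id_comp _)
  comp_id φ := Hom₂.ext (Category.comp_id _)
  assoc φ ψ χ := Hom₂.ext (Category.assoc _ _ _)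

@[ext]
theorem hom₂_ext {f g : PseudoSlice x} {k l : f ⟶ g} {φ ψ : k ⟶ l} (h : φ.left = ψ.left) :
    φ = ψ := Hom₂.ext h

@[simp]
theorem id_left₁ (f : PseudoSlice x) : (𝟙 f : f ⟶ f).left = 𝟙 f.left := rfl

@[simp]
theorem comp_left₁ {f g h : PseudoSlice x} (k : f ⟶ g) (l : g ⟶ h) :
    (k ≫ l).left = k.left ≫ l.left := rfl

@[simp]
theorem id_iso (f : PseudoSlice x) : (𝟙 f : f ⟶ f).iso = λ_ f.hom := rfl

@[simp]
theorem comp_iso {f g h : PseudoSlice x} (k : f ⟶ g) (l : g ⟶ h) :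
    (k ≫ l).iso = α_ k.left l.left h.hom ≪≫ whiskerLeftIso k.left l.iso ≪≫ k.iso := rfl

@[simp]
theorem id_left₂ {f g : PseudoSlice x} (k : f ⟶ g) : (𝟙 k : k ⟶ k).left = 𝟙 k.left := rfl

@[simp]
theorem comp_left₂ {f g : PseudoSlice x} {k l m : f ⟶ g} (φ : k ⟶ l) (ψ : l ⟶ m) :
    (φ ≫ ψ).left = φ.left ≫ ψ.left := rfl

/-- An invertible 2-cell of `B` compatible with the triangles is invertible in the pseudoslice. -/
def mkIso {f g : PseudoSlice x} {k l : f ⟶ g} (φ : k.left ≅ l.left)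
    (w : φ.hom ▷ g.hom ≫ l.iso.hom = k.iso.hom) : k ≅ l where
  hom := ⟨φ.hom, w⟩
  inv := ⟨φ.inv, by rw [← w]; simp⟩
  hom_inv_id := hom₂_ext φ.hom_inv_id
  inv_hom_id := hom₂_ext φ.inv_hom_id

@[simp]
theorem mkIso_hom_left {f g : PseudoSlice x} {k l : f ⟶ g} (φ : k.left ≅ l.left)
    (w : φ.hom ▷ g.hom ≫ l.iso.hom = k.iso.hom) : (mkIso φ w).hom.left = φ.hom := rfl

@[simp]
theorem mkIso_inv_left {f g : PseudoSlice x} {k l : f ⟶ g} (φ : k.left ≅ l.left)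
    (w : φ.hom ▷ g.hom ≫ l.iso.hom = k.iso.hom) : (mkIso φ w).inv.left = φ.inv := rfl

/-- The pseudoslice bicategory `B/x`; its structural 2-cells are those of `B`. -/
instance bicategory : Bicategory (PseudoSlice x) where
  homCategory := homCat
  whiskerLeft k _ _ φ := ⟨k.left ◁ φ.left, by simp [← φ.w]⟩
  whiskerRight {f g h k l} φ m := ⟨φ.left ▷ m.left, by
    have := φ.w
    simp [← this, whisker_exchange_assoc]⟩
  associator k l m := mkIso (α_ k.left l.left m.left) (by simp)
  leftUnitor k := mkIso (λ_ k.left) (by simp)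
  rightUnitor k := mkIso (ρ_ k.left) (by simp)
  whisker_exchange φ ψ := hom₂_ext (whisker_exchange φ.left ψ.left)

end PseudoSlice

end Slice

section Restriction

variable {A : Type u₁} [Bicategory.{w₁, v₁} A] {B : Type u₂} [Bicategory.{w₂, v₂} B]

/-- The restriction `U_a : A/a ⥤ᵖ B/U(a)` of a pseudofunctor `U` to pseudoslices, sending a
triangle `(w, ω)` to `U(w)` with `U(ω)` corrected by the compositor of `U`. -/
def sliceRestriction (U : A ⥤ᵖ B) (a : A) : PseudoSlice a ⥤ᵖ PseudoSlice (U.obj a) where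
  obj u := ⟨U.obj u.left, U.map u.hom⟩
  map {u v} k := ⟨U.map k.left, (U.mapComp k.left v.hom).symm ≪≫ U.map₂Iso k.iso⟩
  map₂ {u v k l} φ := ⟨U.map₂ φ.left, by
    have := φ.w
    simp [← this]⟩
  mapId u := PseudoSlice.mkIso (U.mapId u.left) (by simp)
  mapComp {_ v w} k l := PseudoSlice.mkIso (U.mapComp k.left l.left) (by
    change (U.mapComp k.left l.left).hom ▷ U.map w.hom ≫
      (α_ _ _ _).hom ≫ U.map k.left ◁ ((U.mapComp l.left w.hom).inv ≫ U.map₂ l.iso.hom) ≫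
        (U.mapComp k.left v.hom).inv ≫ U.map₂ k.iso.hom =
      (U.mapComp (k.left ≫ l.left) w.hom).inv ≫
        U.map₂ ((α_ _ _ _).hom ≫ k.left ◁ l.iso.hom ≫ k.iso.hom)
    simp)
  map₂_whisker_left k _ _ φ := PseudoSlice.hom₂_ext (U.map₂_whisker_left k.left φ.left)
  map₂_whisker_right φ m := PseudoSlice.hom₂_ext (U.map₂_whisker_right φ.left m.left)
  map₂_associator k l m := PseudoSlice.hom₂_ext (U.map₂_associator k.left l.left m.left)
  map₂_left_unitor k := PseudoSlice.hom₂_ext (U.map₂_left_unitor k.left)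
  map₂_right_unitor k := PseudoSlice.hom₂_ext (U.map₂_right_unitor k.left)

end Restriction

section Biadjoint

variable {C : Type u₁} [Bicategory.{w₁, v₁} C] {D : Type u₂} [Bicategory.{w₂, v₂} D]

/-- Given a 1-cell `h : d ⟶ R c`, the functor between hom-categories `C(c, u) ⥤ D(d, R u)` which
applies `R` and precomposes with `h`. -/
def transpose (R : C ⥤ᵖ D) {c : C} {d : D} (h : d ⟶ R.obj c) (u : C) :
    (c ⟶ u) ⥤ (d ⟶ R.obj u) where
  obj w := h ≫ R.map w
  map σ := h ◁ R.map₂ σ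

/-- A left biadjoint of a pseudofunctor `R : C ⥤ᵖ D`: a pseudofunctor `L : D ⥤ᵖ C` and a
pseudonatural transformation `unit : 𝟭 ⟶ R L` such that applying `R` and precomposing with
the unit is an equivalence of hom-categories `C(L d, u) ≌ D(d, R u)` for all `d` and `u`. -/
structure LeftBiadjoint (R : C ⥤ᵖ D) where
  /-- the left biadjoint -/
  L : D ⥤ᵖ C
  /-- the unit of the biadjunction -/
  unit : Pseudofunctor.StrongTrans (Pseudofunctor.id D) (L.comp R)
  isEquivalence_transpose (d : D) (u : C) :
    (transpose R (c := L.obj d) (unit.app d) u).IsEquivalence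

end Biadjoint

section Stability

variable {A : Type u₁} [Bicategory.{w₁, v₁} A] {B : Type u₂} [Bicategory.{w₂, v₂} B]

/-- A pseudofunctor `U` is a local right biadjoint if each of its restrictions to pseudoslices has
a left biadjoint. -/
def IsLocalRightBiadjoint (U : A ⥤ᵖ B) : Prop :=
  ∀ a : A, Nonempty (LeftBiadjoint (sliceRestriction U a))

/-- A diagonal filler of a pseudosquare `α : U(u) f ≅ U(v) n` from `n` to `U(u)`: a 1-cell `diag`
with invertible 2-cells `ν : f ≅ U(diag) n` and `ω : u diag ≅ v` whose pasting is `α`. -/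
structure Filler (U : A ⥤ᵖ B) {b : B} {a a₁ a₂ : A} (n : b ⟶ U.obj a) (u : a₁ ⟶ a₂) (v : a ⟶ a₂)
    (f : b ⟶ U.obj a₁) (α : f ≫ U.map u ≅ n ≫ U.map v) where
  /-- the diagonal -/
  diag : a ⟶ a₁
  /-- the upper triangle, in `B` -/
  ν : f ≅ n ≫ U.map diag
  /-- the lower triangle, in `A` -/
  ω : diag ≫ u ≅ v
  pasting : ν.hom ▷ U.map u ≫ (α_ n (U.map diag) (U.map u)).hom ≫
    n ◁ (U.mapComp diag u).inv ≫ n ◁ U.map₂ ω.hom = α.hom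

/-- A 1-cell `n : b ⟶ U a` is `U`-generic if every pseudosquare from `n` to some `U(u)` with bottom
side some `U(v)` has a filler, unique up to a unique compatible invertible 2-cell, and every
morphism of such pseudosquares (given by a 2-cell `φ` on the top side) induces a unique compatible
2-cell between the fillers. -/
structure IsGeneric (U : A ⥤ᵖ B) {b : B} {a : A} (n : b ⟶ U.obj a) : Prop where
  exists_filler {a₁ a₂ : A} (u : a₁ ⟶ a₂) (v : a ⟶ a₂) (f : b ⟶ U.obj a₁)
    (α : f ≫ U.map u ≅ n ≫ U.map v) : Nonempty (Filler U n u v f α)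
  existsUnique_iso {a₁ a₂ : A} {u : a₁ ⟶ a₂} {v : a ⟶ a₂} {f : b ⟶ U.obj a₁}
    {α : f ≫ U.map u ≅ n ≫ U.map v} (F F' : Filler U n u v f α) :
    ∃! θ : F.diag ≅ F'.diag,
      θ.hom ▷ u ≫ F'.ω.hom = F.ω.hom ∧ F.ν.hom ≫ n ◁ U.map₂ θ.hom = F'.ν.hom
  existsUnique_two_cell {a₁ a₂ : A} {u : a₁ ⟶ a₂} {v : a ⟶ a₂} {f₁ f₂ : b ⟶ U.obj a₁}
    {α₁ : f₁ ≫ U.map u ≅ n ≫ U.map v} {α₂ : f₂ ≫ U.map u ≅ n ≫ U.map v}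
    (φ : f₁ ⟶ f₂) (_ : φ ▷ U.map u ≫ α₂.hom = α₁.hom)
    (F₁ : Filler U n u v f₁ α₁) (F₂ : Filler U n u v f₂ α₂) :
    ∃! σ : F₁.diag ⟶ F₂.diag,
      σ ▷ u ≫ F₂.ω.hom = F₁.ω.hom ∧ F₁.ν.hom ≫ n ◁ U.map₂ σ = φ ≫ F₂.ν.hom

/-- A generic factorization `U(right) left ≅ f` of `f : b ⟶ U a`: its left part is `U`-generic. -/
structure GenericFactorization (U : A ⥤ᵖ B) {b : B} {a : A} (f : b ⟶ U.obj a) where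
  /-- the middle object -/
  mid : A
  /-- the generic part -/
  left : b ⟶ U.obj mid
  /-- the right part, in `A` -/
  right : mid ⟶ a
  /-- the invertible 2-cell filling the triangle -/
  iso : left ≫ U.map right ≅ f
  generic : IsGeneric U left

/-- A comparison from a generic factorization `G` of `f` to another one `F`: an equivalence `e`
between the middle objects with invertible 2-cells `ν : U(e) n_G ≅ n_F` in `B` and
`ω : u_F e ≅ u_G` in `A` whose pasting with the 2-cell of `F` is the 2-cell of `G`. -/
structure Comparison (U : A ⥤ᵖ B) {b : B} {a : A} {f : b ⟶ U.obj a}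
    (G F : GenericFactorization U f) where
  /-- the underlying 1-cell -/
  e : G.mid ⟶ F.mid
  isEquivalence : IsEquivalence₁ e
  /-- the left triangle -/
  ν : G.left ≫ U.map e ≅ F.left
  /-- the right triangle -/
  ω : e ≫ F.right ≅ G.right
  pasting : G.left ◁ U.map₂ ω.inv ≫ G.left ◁ (U.mapComp e F.right).hom ≫
    (α_ G.left (U.map e) (U.map F.right)).inv ≫ ν.hom ▷ U.map F.right ≫ F.iso.hom = G.iso.hom

/-- A pseudofunctor `U` is bistable if every `f : b ⟶ U a` has a generic factorization, to which
every generic factorization of `f` is compared by an equivalence that is unique up to a unique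
compatible invertible 2-cell. -/
def IsBistable (U : A ⥤ᵖ B) : Prop :=
  ∀ ⦃b : B⦄ ⦃a : A⦄ (f : b ⟶ U.obj a), ∃ F : GenericFactorization U f,
    ∀ G : GenericFactorization U f, Nonempty (Comparison U G F) ∧
      ∀ c c' : Comparison U G F, ∃! θ : c.e ≅ c'.e,
        θ.hom ▷ F.right ≫ c'.ω.hom = c.ω.hom ∧ G.left ◁ U.map₂ θ.hom ≫ c'.ν.hom = c.ν.hom

/-- A 1-cell `n : b ⟶ U a` is a local unit of `U` if it underlies the component at some
`f : b ⟶ U a₀` of the unit of some left biadjoint of the restriction `A/a₀ ⥤ᵖ B/U(a₀)`. -/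
def IsLocalUnit (U : A ⥤ᵖ B) {b : B} {a : A} (n : b ⟶ U.obj a) : Prop :=
  ∃ (a₀ : A) (Λ : LeftBiadjoint (sliceRestriction U a₀)) (f : b ⟶ U.obj a₀),
    (⟨(Λ.L.obj ⟨b, f⟩).left, (Λ.unit.app ⟨b, f⟩).left⟩ : Σ a' : A, b ⟶ U.obj a') = ⟨a, n⟩

end Stability

end TwoDimStability

/-! A 1-cell from `f` to `U_{a₂}(v)` in the pseudoslice over `U(a₂)` is a pair `(n, κ)` with `κ :
U(v)n ≅ f`. Pasting with `κ` turns triangles over `f` into pseudosquares with bottom side `U(v)n`.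
Under this translation essential surjectivity of transposition along `(n, κ)` is existence of
fillers, and full faithfulness is the unique 2-cell between fillers. So `(n, κ)` is biuniversal
precisely when `n` is generic for squares with bottom `v` (`isGenericAt_of_isBiuniversal`,
`IsGenericAt.isBiuniversal`), and genericity is this condition for all `v`.

Generic factorizations therefore supply biuniversal 1-cells, which assemble into a left biadjoint
with the prescribed values (`leftBiadjointOfBiuniversal`).

Conversely, a unit component is a priori generic only at the single 1-cell `L_A(f)`. Genericity at a
composite passes to its first factor (`IsGenericAt.of_comp`), in particular to the identity. Given
any `v`, the left biadjoint over the codomain of `v` factors `U(v)n` through a unit component, and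
the induced 1-cell to the domain of `v` is an equivalence, because two biuniversal 1-cells are being
compared. Genericity at `v` is transported along it (`IsGenericAt.isGeneric`).

Comparisons between generic factorizations are fillers, hence exist and are unique without further
assumptions, so bistability is only a question of existence. -/

namespace TwoDimStability

/-! ### Biuniversal 1-cells and the calculus of lifts -/

section Universal

variable {C : Type u₁} [Bicategory.{w₁, v₁} C] {D : Type u₂} [Bicategory.{w₂, v₂} D]

/-- A 1-cell `h : d ⟶ R c` is biuniversal from `d` to `R` if transposition along it is an
equivalence of hom-categories. -/
def IsBiuniversal (R : C ⥤ᵖ D) {c : C} {d : D} (h : d ⟶ R.obj c) : Prop :=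
  ∀ u : C, (transpose R h u).IsEquivalence

/-- A lift of `k : d ⟶ d'` along 1-cells `h : d ⟶ R c` and `h' : d' ⟶ R c'`: a 1-cell `c ⟶ c'`
whose image under `R` corresponds to `k` up to an invertible 2-cell. -/
structure Lift (R : C ⥤ᵖ D) {c c' : C} {d d' : D} (h : d ⟶ R.obj c) (h' : d' ⟶ R.obj c')
    (k : d ⟶ d') where
  /-- the underlying 1-cell -/
  map : c ⟶ c'
  /-- the invertible 2-cell filling the square -/
  iso : k ≫ h' ≅ h ≫ R.map map

namespace Lift

variable {R : C ⥤ᵖ D} {c c' c'' c''' : C} {d d' d'' d''' : D} {h : d ⟶ R.obj c}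
  {h' : d' ⟶ R.obj c'} {h'' : d'' ⟶ R.obj c''} {h''' : d''' ⟶ R.obj c'''}

/-- The identity lifts the identity. -/
def id (R : C ⥤ᵖ D) {c : C} {d : D} (h : d ⟶ R.obj c) : Lift R h h (𝟙 d) where
  map := 𝟙 c
  iso := λ_ h ≪≫ (ρ_ h).symm ≪≫ whiskerLeftIso h (R.mapId c).symm

/-- Lifts compose by pasting. -/
def comp {k : d ⟶ d'} {l : d' ⟶ d''} (w : Lift R h h' k) (w' : Lift R h' h'' l) :
    Lift R h h'' (k ≫ l) where
  map := w.map ≫ w'.map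
  iso := α_ k l h'' ≪≫ whiskerLeftIso k w'.iso ≪≫ (α_ k h' (R.map w'.map)).symm ≪≫
    whiskerRightIso w.iso (R.map w'.map) ≪≫ α_ h (R.map w.map) (R.map w'.map) ≪≫
    whiskerLeftIso h (R.mapComp w.map w'.map).symm

/-- A 2-cell between lifts lies over the 2-cell `φ` between the lifted 1-cells if it corresponds
to `φ` under transposition. -/
def LiesOver {k l : d ⟶ d'} (w : Lift R h h' k) (w' : Lift R h h' l) (φ : k ⟶ l)
    (σ : w.map ⟶ w'.map) : Prop :=
  w.iso.hom ≫ h ◁ R.map₂ σ = φ ▷ h' ≫ w'.iso.hom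

theorem LiesOver.congr {k l : d ⟶ d'} {w : Lift R h h' k} {w' : Lift R h h' l} {φ ψ : k ⟶ l}
    {σ : w.map ⟶ w'.map} (hσ : LiesOver w w' φ σ) (hφ : φ = ψ) : LiesOver w w' ψ σ :=
  hφ ▸ hσ

theorem LiesOver.id {k : d ⟶ d'} (w : Lift R h h' k) : LiesOver w w (𝟙 k) (𝟙 w.map) := by
  simp [LiesOver]

theorem LiesOver.comp {k l m : d ⟶ d'} {w₁ : Lift R h h' k} {w₂ : Lift R h h' l}
    {w₃ : Lift R h h' m} {φ : k ⟶ l} {ψ : l ⟶ m} {σ : w₁.map ⟶ w₂.map} {τ : w₂.map ⟶ w₃.map}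
    (hσ : LiesOver w₁ w₂ φ σ) (hτ : LiesOver w₂ w₃ ψ τ) : LiesOver w₁ w₃ (φ ≫ ψ) (σ ≫ τ) := by
  unfold LiesOver at *
  simp [reassoc_of% hσ, hτ]

theorem LiesOver.inv {k l : d ⟶ d'} {w : Lift R h h' k} {w' : Lift R h h' l} {φ : k ≅ l}
    {σ : w.map ≅ w'.map} (hσ : LiesOver w w' φ.hom σ.hom) : LiesOver w' w φ.inv σ.inv := by
  unfold LiesOver at *
  rw [← cancel_epi (φ.hom ▷ h'), ← reassoc_of% hσ, ← whiskerLeft_comp, ← PrelaxFunctor.map₂_comp]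
  simp

/-- With the lemmas below, this makes lying over stable under every bicategorical operation, so an
equation between 2-cells of lifts can be checked on the 2-cells they lie over. -/
theorem LiesOver.whiskerLeft {k : d ⟶ d'} {l m : d' ⟶ d''} (w : Lift R h h' k)
    {w₁ : Lift R h' h'' l} {w₂ : Lift R h' h'' m} {φ : l ⟶ m} {σ : w₁.map ⟶ w₂.map}
    (hσ : LiesOver w₁ w₂ φ σ) : LiesOver (w.comp w₁) (w.comp w₂) (k ◁ φ) (w.map ◁ σ) := by
  unfold LiesOver at *
  have := congrArg (k ◁ ·) hσ
  simp only [Bicategory.whiskerLeft_comp] at this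
  simp only [Lift.comp, Iso.trans_hom, whiskerLeftIso_hom, Iso.symm_hom, whiskerRightIso_hom,
    Category.assoc, Pseudofunctor.map₂_whisker_left, Bicategory.whiskerLeft_comp,
    whiskerLeft_inv_hom_assoc]
  rw [whisker_assoc_assoc]
  simp only [Iso.inv_hom_id_assoc, ← reassoc_of% this]
  rw [associator_inv_naturality_right_assoc, whisker_exchange_assoc,
    associator_naturality_right_assoc]

theorem LiesOver.whiskerRight {k l : d ⟶ d'} {m : d' ⟶ d''} {w₁ : Lift R h h' k}
    {w₂ : Lift R h h' l} {φ : k ⟶ l} {σ : w₁.map ⟶ w₂.map}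
    (hσ : LiesOver w₁ w₂ φ σ) (w : Lift R h' h'' m) :
    LiesOver (w₁.comp w) (w₂.comp w) (φ ▷ m) (σ ▷ w.map) := by
  unfold LiesOver at *
  have := congrArg (· ▷ R.map w.map) hσ
  simp only [Bicategory.comp_whiskerRight] at this
  simp [Lift.comp]
  rw [associator_naturality_left_assoc, ← whisker_exchange_assoc,
    associator_inv_naturality_left_assoc, ← reassoc_of% this]
  simp


theorem LiesOver.associator {k : d ⟶ d'} {l : d' ⟶ d''} {m : d'' ⟶ d'''} (w : Lift R h h' k)
    (w' : Lift R h' h'' l) (w'' : Lift R h'' h''' m) :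
    LiesOver ((w.comp w').comp w'') (w.comp (w'.comp w'')) (α_ k l m).hom
      (α_ w.map w'.map w''.map).hom := by
  simp [LiesOver, Lift.comp]
  rw [associator_inv_naturality_right_assoc, whisker_exchange_assoc,
    associator_naturality_right_assoc]
  simp


theorem LiesOver.leftUnitor {k : d ⟶ d'} (w : Lift R h h' k) :
    LiesOver ((Lift.id R h).comp w) w (λ_ k).hom (λ_ w.map).hom := by
  simp [LiesOver, Lift.comp, Lift.id]

theorem LiesOver.rightUnitor {k : d ⟶ d'} (w : Lift R h h' k) :
    LiesOver (w.comp (Lift.id R h')) w (ρ_ k).hom (ρ_ w.map).hom := by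
  simp [LiesOver, Lift.comp, Lift.id]
  rw [associator_inv_naturality_right_assoc, whisker_exchange_assoc,
    associator_naturality_right_assoc]
  simp


/-- Here and in `comp_mapComp`, lying over an identity is rewritten as a unit or composition axiom
of a pseudonatural transformation. -/
theorem LiesOver.comp_mapId {w : Lift R h h (𝟙 d)} {σ : w.map ⟶ 𝟙 c}
    (hσ : LiesOver w (Lift.id R h) (𝟙 (𝟙 d)) σ) :
    w.iso.hom ≫ h ◁ (R.map₂ σ ≫ (R.mapId c).hom) =
      𝟙 (𝟙 d) ▷ h ≫ (λ_ h).hom ≫ (ρ_ h).inv := by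
  replace hσ : w.iso.hom ≫ h ◁ R.map₂ σ =
    𝟙 (𝟙 d) ▷ h ≫ (λ_ h).hom ≫ (ρ_ h).inv ≫ h ◁ (R.mapId c).inv := hσ
  simp [reassoc_of% hσ]

theorem LiesOver.comp_mapComp {k : d ⟶ d'} {l : d' ⟶ d''} {w : Lift R h h' k}
    {w' : Lift R h' h'' l} {w'' : Lift R h h'' (k ≫ l)} {σ : w''.map ⟶ w.map ≫ w'.map}
    (hσ : LiesOver w'' (w.comp w') (𝟙 (k ≫ l)) σ) :
    w''.iso.hom ≫ h ◁ (R.map₂ σ ≫ (R.mapComp w.map w'.map).hom) =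
      𝟙 (k ≫ l) ▷ h'' ≫ (α_ k l h'').hom ≫ k ◁ w'.iso.hom ≫ (α_ k h' (R.map w'.map)).inv ≫
        w.iso.hom ▷ R.map w'.map ≫ (α_ h (R.map w.map) (R.map w'.map)).hom := by
  replace hσ : w''.iso.hom ≫ h ◁ R.map₂ σ = 𝟙 (k ≫ l) ▷ h'' ≫ (α_ k l h'').hom ≫
    k ◁ w'.iso.hom ≫ (α_ k h' (R.map w'.map)).inv ≫ w.iso.hom ▷ R.map w'.map ≫
      (α_ h (R.map w.map) (R.map w'.map)).hom ≫ h ◁ (R.mapComp w.map w'.map).inv := hσ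
  simp [reassoc_of% hσ]

end Lift

namespace IsBiuniversal

variable {R : C ⥤ᵖ D} {c c' : C} {d d' : D} {h : d ⟶ R.obj c} {h' : d' ⟶ R.obj c'}

/-- Faithfulness of transposition; the next lemmas use its fullness and essential surjectivity. -/
theorem liesOver_unique (H : IsBiuniversal R h) {k l : d ⟶ d'} {w : Lift R h h' k}
    {w' : Lift R h h' l} {φ : k ⟶ l} {σ τ : w.map ⟶ w'.map} (hσ : w.LiesOver w' φ σ)
    (hτ : w.LiesOver w' φ τ) : σ = τ := by
  have := H c'
  refine (transpose R h c').map_injective ?_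
  exact (cancel_epi w.iso.hom).1 (hσ.trans hτ.symm)

theorem exists_liesOver (H : IsBiuniversal R h) {k l : d ⟶ d'} (w : Lift R h h' k)
    (w' : Lift R h h' l) (φ : k ⟶ l) : ∃ σ : w.map ⟶ w'.map, w.LiesOver w' φ σ := by
  have := H c'
  obtain ⟨σ, hσ⟩ := (transpose R h c').map_surjective (X := w.map) (Y := w'.map)
    (w.iso.inv ≫ φ ▷ h' ≫ w'.iso.hom)
  refine ⟨σ, ?_⟩
  rw [Lift.LiesOver, ← Iso.eq_inv_comp]
  exact hσ

theorem exists_iso_liesOver (H : IsBiuniversal R h) {k l : d ⟶ d'} (w : Lift R h h' k)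
    (w' : Lift R h h' l) (φ : k ≅ l) : ∃ σ : w.map ≅ w'.map, w.LiesOver w' φ.hom σ.hom := by
  obtain ⟨σ, hσ⟩ := H.exists_liesOver w w' φ.hom
  obtain ⟨τ, hτ⟩ := H.exists_liesOver w' w φ.inv
  refine ⟨⟨σ, τ, H.liesOver_unique (φ := 𝟙 k) ?_ (.id w), H.liesOver_unique (φ := 𝟙 l) ?_ (.id w')⟩,
    hσ⟩
  · simpa using hσ.comp hτ
  · simpa using hτ.comp hσ

theorem nonempty_lift (H : IsBiuniversal R h) (h' : d' ⟶ R.obj c') (k : d ⟶ d') :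
    Nonempty (Lift R h h' k) := by
  have := H c'
  exact ⟨⟨(transpose R h c').objPreimage (k ≫ h'),
    ((transpose R h c').objObjPreimageIso (k ≫ h')).symm⟩⟩

end IsBiuniversal

/-! ### A left biadjoint from a choice of biuniversal 1-cells -/

section LeftBiadjointOfBiuniversal

variable {R : C ⥤ᵖ D} {c : D → C} {h : ∀ d, d ⟶ R.obj (c d)} (H : ∀ d, IsBiuniversal R (h d))

/-- A chosen lift of a 1-cell along a family of biuniversal 1-cells. -/
noncomputable def chosenLift {d d' : D} (k : d ⟶ d') : Lift R (h d) (h d') k :=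
  ((H d).nonempty_lift (h d') k).some

/-- The 2-cell between lifts lying over a 2-cell. -/
noncomputable def lift₂ {d d' : D} {k l : d ⟶ d'} (w : Lift R (h d) (h d') k)
    (w' : Lift R (h d) (h d') l) (φ : k ⟶ l) : w.map ⟶ w'.map :=
  ((H d).exists_liesOver w w' φ).choose

theorem lift₂_liesOver {d d' : D} {k l : d ⟶ d'} (w : Lift R (h d) (h d') k)
    (w' : Lift R (h d) (h d') l) (φ : k ⟶ l) : w.LiesOver w' φ (lift₂ H w w' φ) :=
  ((H d).exists_liesOver w w' φ).choose_spec

/-- The invertible 2-cell between two lifts of the same 1-cell. -/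
noncomputable def liftIso {d d' : D} {k : d ⟶ d'} (w w' : Lift R (h d) (h d') k) :
    w.map ≅ w'.map :=
  ((H d).exists_iso_liesOver w w' (Iso.refl k)).choose

theorem liftIso_liesOver {d d' : D} {k : d ⟶ d'} (w w' : Lift R (h d) (h d') k) :
    w.LiesOver w' (𝟙 k) (liftIso H w w').hom :=
  ((H d).exists_iso_liesOver w w' (Iso.refl k)).choose_spec

theorem liftIso_inv_liesOver {d d' : D} {k : d ⟶ d'} (w w' : Lift R (h d) (h d') k) :
    w'.LiesOver w (𝟙 k) (liftIso H w w').inv :=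
  Lift.LiesOver.inv (φ := Iso.refl k) (liftIso_liesOver H w w')

open Lift in
/-- The pseudofunctor determined by a choice of biuniversal 1-cells. -/
noncomputable def leftPseudofunctor : D ⥤ᵖ C where
  obj := c
  map k := (chosenLift H k).map
  map₂ φ := lift₂ H _ _ φ
  map₂_id k := (H _).liesOver_unique (lift₂_liesOver H _ _ _) (.id _)
  map₂_comp φ ψ := (H _).liesOver_unique (lift₂_liesOver H _ _ _)
    ((lift₂_liesOver H _ _ φ).comp (lift₂_liesOver H _ _ ψ))
  mapId d := liftIso H (chosenLift H (𝟙 d)) (Lift.id R (h d))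
  mapComp k l := liftIso H (chosenLift H (k ≫ l)) ((chosenLift H k).comp (chosenLift H l))
  -- As for the other axioms, both sides lie over the same 2-cell of `D`, so they agree by
  -- uniqueness; `simp` identifies the 2-cells below.
  map₂_whisker_left k _ _ φ := (H _).liesOver_unique (lift₂_liesOver H _ _ (k ◁ φ)) (LiesOver.congr
    ((liftIso_liesOver H (chosenLift H (k ≫ _)) _).comp
      ((LiesOver.whiskerLeft (chosenLift H k) (lift₂_liesOver H _ _ φ)).comp
        (liftIso_inv_liesOver H (chosenLift H (k ≫ _)) _))) (by simp))
  map₂_whisker_right φ k := (H _).liesOver_unique (lift₂_liesOver H _ _ (φ ▷ k)) (LiesOver.congr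
    ((liftIso_liesOver H (chosenLift H (_ ≫ k)) _).comp
      ((LiesOver.whiskerRight (lift₂_liesOver H _ _ φ) (chosenLift H k)).comp
        (liftIso_inv_liesOver H (chosenLift H (_ ≫ k)) _))) (by simp))
  map₂_associator k l m := (H _).liesOver_unique (lift₂_liesOver H _ _ (α_ k l m).hom)
    (LiesOver.congr
    ((liftIso_liesOver H (chosenLift H ((k ≫ l) ≫ m)) _).comp
      ((LiesOver.whiskerRight (liftIso_liesOver H (chosenLift H (k ≫ l)) _) (chosenLift H m)).comp
        ((LiesOver.associator (chosenLift H k) (chosenLift H l) (chosenLift H m)).comp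
          ((LiesOver.whiskerLeft (chosenLift H k)
            (liftIso_inv_liesOver H (chosenLift H (l ≫ m)) _)).comp
              (liftIso_inv_liesOver H (chosenLift H (k ≫ l ≫ m)) _))))) (by simp))
  map₂_left_unitor k := (H _).liesOver_unique (lift₂_liesOver H _ _ (λ_ k).hom) (LiesOver.congr
    ((liftIso_liesOver H (chosenLift H (𝟙 _ ≫ k)) _).comp
      ((LiesOver.whiskerRight (liftIso_liesOver H (chosenLift H (𝟙 _)) _) (chosenLift H k)).comp
        (LiesOver.leftUnitor (chosenLift H k)))) (by simp))
  map₂_right_unitor k := (H _).liesOver_unique (lift₂_liesOver H _ _ (ρ_ k).hom) (LiesOver.congr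
    ((liftIso_liesOver H (chosenLift H (k ≫ 𝟙 _)) _).comp
      ((LiesOver.whiskerLeft (chosenLift H k) (liftIso_liesOver H (chosenLift H (𝟙 _)) _)).comp
        (LiesOver.rightUnitor (chosenLift H k)))) (by simp))

/-- A choice of biuniversal 1-cells underlies a left biadjoint. -/
noncomputable def leftBiadjointOfBiuniversal : LeftBiadjoint R where
  L := leftPseudofunctor H
  unit :=
    { app := h
      naturality k := (chosenLift H k).iso
      naturality_naturality φ := (lift₂_liesOver H _ _ φ).symm
      naturality_id d := Lift.LiesOver.comp_mapId
        (liftIso_liesOver H (chosenLift H (𝟙 d)) (Lift.id R (h d)))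
      naturality_comp k l := Lift.LiesOver.comp_mapComp (liftIso_liesOver H (chosenLift H (k ≫ l))
        ((chosenLift H k).comp (chosenLift H l))) }
  isEquivalence_transpose d u := H d u

end LeftBiadjointOfBiuniversal

/-- No triangle identity is needed: the counit can be corrected to satisfy it. -/
theorem isEquivalence₁_of_iso {a b : C} {e : a ⟶ b} {g : b ⟶ a} (η : 𝟙 a ≅ e ≫ g)
    (ι : g ≫ e ≅ 𝟙 b) : IsEquivalence₁ e :=
  ⟨Bicategory.Equivalence.mkOfAdjointifyCounit η ι, rfl⟩

namespace IsBiuniversal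

variable {R : C ⥤ᵖ D} {c c' : C} {d : D} {h : d ⟶ R.obj c} {h' : d ⟶ R.obj c'}

/-- The identity also lifts backwards; each round trip and the identity lift are isomorphic over the
unitor of `𝟙 d`. -/
theorem isEquivalence₁_lift (H : IsBiuniversal R h) (H' : IsBiuniversal R h')
    (w : Lift R h h' (𝟙 d)) : IsEquivalence₁ w.map := by
  obtain ⟨w'⟩ := H'.nonempty_lift h (𝟙 d)
  obtain ⟨η, -⟩ := H.exists_iso_liesOver (Lift.id R h) (w.comp w') (λ_ (𝟙 d)).symm
  obtain ⟨ι, -⟩ := H'.exists_iso_liesOver (w'.comp w) (Lift.id R h') (λ_ (𝟙 d))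
  exact isEquivalence₁_of_iso η ι

end IsBiuniversal

theorem IsEquivalence₁.isEquivalence_precomp {a b : C} {e : a ⟶ b} (he : IsEquivalence₁ e) (x : C) :
    (precomp x e).IsEquivalence := by
  obtain ⟨E, rfl⟩ := he
  refine (CategoryTheory.Equivalence.mk (precomp x E.hom) (precomp x E.inv)
    (NatIso.ofComponents (fun k => (λ_ k).symm ≪≫ whiskerRightIso E.counit.symm k ≪≫ α_ _ _ _) ?_)
    (NatIso.ofComponents (fun k => (α_ _ _ _).symm ≪≫ whiskerRightIso E.unit.symm k ≪≫ λ_ k)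
      ?_)).isEquivalence_functor
  · intro k l σ
    change σ ≫ (λ_ l).inv ≫ E.counit.inv ▷ l ≫ (α_ _ _ _).hom =
      ((λ_ k).inv ≫ E.counit.inv ▷ k ≫ (α_ _ _ _).hom) ≫ E.inv ◁ E.hom ◁ σ
    simp only [Category.assoc]
    rw [← associator_naturality_right, ← whisker_exchange_assoc]
    simp
  · intro k l σ
    change E.hom ◁ E.inv ◁ σ ≫ (α_ _ _ _).inv ≫ E.unit.inv ▷ l ≫ (λ_ l).hom =
      ((α_ _ _ _).inv ≫ E.unit.inv ▷ k ≫ (λ_ k).hom) ≫ σ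
    rw [associator_inv_naturality_right_assoc, whisker_exchange_assoc]
    simp

/-- Transposition along `h'` is, up to isomorphism, precomposition with `e` followed by
transposition along `h`. -/
theorem IsBiuniversal.of_isEquivalence₁ {R : C ⥤ᵖ D} {c c' : C} {d : D} {h : d ⟶ R.obj c}
    {h' : d ⟶ R.obj c'} (H : IsBiuniversal R h) {e : c ⟶ c'} (he : IsEquivalence₁ e)
    (κ : h ≫ R.map e ≅ h') : IsBiuniversal R h' := fun u => by
  have := H u
  have := he.isEquivalence_precomp u
  refine Functor.isEquivalence_of_iso (F := precomp u e ⋙ transpose R h u)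
    (NatIso.ofComponents (fun k => whiskerLeftIso h (R.mapComp e k) ≪≫ (α_ _ _ _).symm ≪≫
      whiskerRightIso κ (R.map k)) ?_)
  intro k l σ
  change h ◁ R.map₂ (e ◁ σ) ≫ h ◁ (R.mapComp e l).hom ≫ (α_ _ _ _).inv ≫ κ.hom ▷ R.map l =
    (h ◁ (R.mapComp e k).hom ≫ (α_ _ _ _).inv ≫ κ.hom ▷ R.map k) ≫ h' ◁ R.map₂ σ
  simp only [Category.assoc, ← whisker_exchange, R.map₂_whisker_left, whiskerLeft_comp,
    whiskerLeft_inv_hom_assoc]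
  rw [associator_inv_naturality_right_assoc]

end Universal

/-! ### Equivalences in pseudoslices -/

section SliceEquivalence

variable {C : Type u₁} [Bicategory.{w₁, v₁} C] {x : C}

/-- The 2-cell underlying an invertible 2-cell of a pseudoslice is invertible. -/
def PseudoSlice.leftIso {f g : PseudoSlice x} {k l : f ⟶ g} (i : k ≅ l) : k.left ≅ l.left where
  hom := i.hom.left
  inv := i.inv.left
  hom_inv_id := congrArg Hom₂.left i.hom_inv_id
  inv_hom_id := congrArg Hom₂.left i.inv_hom_id

theorem IsEquivalence₁.left {f g : PseudoSlice x} {e : f ⟶ g} (he : IsEquivalence₁ e) :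
    IsEquivalence₁ e.left := by
  obtain ⟨E, rfl⟩ := he
  exact isEquivalence₁_of_iso (PseudoSlice.leftIso E.unit) (PseudoSlice.leftIso E.counit)

theorem IsEquivalence₁.of_left {f g : PseudoSlice x} {e : f ⟶ g} (he : IsEquivalence₁ e.left) :
    IsEquivalence₁ e := by
  obtain ⟨w, κ⟩ := e
  obtain ⟨E, rfl : E.hom = w⟩ := he
  let e' : g ⟶ f := ⟨E.inv, whiskerLeftIso E.inv κ.symm ≪≫ (α_ _ _ _).symm ≪≫
    whiskerRightIso E.counit g.hom ≪≫ λ_ g.hom⟩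
  refine isEquivalence₁_of_iso (g := e') (PseudoSlice.mkIso E.unit ?_)
    (PseudoSlice.mkIso E.counit ?_)
  -- The triangle of `e'` is built from the counit, so compatibility of the counit is formal and
  -- compatibility of the unit is this triangle identity.
  · have hE : E.unit.hom ▷ E.hom ≫ (α_ _ _ _).hom ≫ E.hom ◁ E.counit.hom =
        (λ_ E.hom).hom ≫ (ρ_ E.hom).inv := by
      simpa [leftZigzag, bicategoricalComp] using E.left_triangle_hom
    have := congrArg (· ▷ g.hom) hE
    change E.unit.hom ▷ f.hom ≫ (α_ _ _ _).hom ≫ E.hom ◁ (E.inv ◁ κ.inv ≫ (α_ _ _ _).inv ≫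
      E.counit.hom ▷ g.hom ≫ (λ_ g.hom).hom) ≫ κ.hom = (λ_ f.hom).hom
    rw [whiskerLeft_comp_assoc, ← associator_naturality_right_assoc, ← whisker_exchange_assoc]
    have key : E.unit.hom ▷ (E.hom ≫ g.hom) ≫ (α_ E.hom E.inv (E.hom ≫ g.hom)).hom ≫
        E.hom ◁ ((α_ E.inv E.hom g.hom).inv ≫ E.counit.hom ▷ g.hom ≫ (λ_ g.hom).hom) =
        (λ_ (E.hom ≫ g.hom)).hom := by
      simp only [comp_whiskerRight] at this
      rw [← cancel_epi (α_ (𝟙 _) E.hom g.hom).hom]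
      trans (E.unit.hom ▷ E.hom ▷ g.hom ≫ (α_ E.hom E.inv E.hom).hom ▷ g.hom ≫
        (E.hom ◁ E.counit.hom) ▷ g.hom) ≫ (α_ _ _ _).hom ≫ E.hom ◁ (λ_ g.hom).hom
      · simp
      · rw [this]
        simp
    rw [reassoc_of% key]
    simp
  · change E.counit.hom ▷ g.hom ≫ (λ_ g.hom).hom = (α_ _ _ _).hom ≫ E.inv ◁ κ.hom ≫
      E.inv ◁ κ.inv ≫ (α_ _ _ _).inv ≫ E.counit.hom ▷ g.hom ≫ (λ_ g.hom).hom
    simp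

end SliceEquivalence

/-! ### Genericity at a fixed bottom side as biuniversality -/

section Generic

variable {A : Type u₁} [Bicategory.{w₁, v₁} A] {B : Type u₂} [Bicategory.{w₂, v₂} B]

/-- Genericity of `n : b ⟶ U a` tested only against the pseudosquares with bottom side `U(v)`, for a
fixed `v`. -/
structure IsGenericAt (U : A ⥤ᵖ B) {b : B} {a a₂ : A} (n : b ⟶ U.obj a) (v : a ⟶ a₂) : Prop where
  exists_filler {a₁ : A} (u : a₁ ⟶ a₂) (f : b ⟶ U.obj a₁)
    (α : f ≫ U.map u ≅ n ≫ U.map v) : Nonempty (Filler U n u v f α)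
  existsUnique_two_cell {a₁ : A} {u : a₁ ⟶ a₂} {f₁ f₂ : b ⟶ U.obj a₁}
    {α₁ : f₁ ≫ U.map u ≅ n ≫ U.map v} {α₂ : f₂ ≫ U.map u ≅ n ≫ U.map v}
    (φ : f₁ ⟶ f₂) (_ : φ ▷ U.map u ≫ α₂.hom = α₁.hom)
    (F₁ : Filler U n u v f₁ α₁) (F₂ : Filler U n u v f₂ α₂) :
    ∃! σ : F₁.diag ⟶ F₂.diag,
      σ ▷ u ≫ F₂.ω.hom = F₁.ω.hom ∧ F₁.ν.hom ≫ n ◁ U.map₂ σ = φ ≫ F₂.ν.hom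

variable {U : A ⥤ᵖ B} {b : B} {a a₁ a₂ : A} {n : b ⟶ U.obj a} {v : a ⟶ a₂}

/-- The 2-cell clause for the identity of `f`, used in both directions, already gives the invertible
comparison. -/
theorem IsGenericAt.existsUnique_iso (H : IsGenericAt U n v) {u : a₁ ⟶ a₂} {f : b ⟶ U.obj a₁}
    {α : f ≫ U.map u ≅ n ≫ U.map v} (F F' : Filler U n u v f α) :
    ∃! θ : F.diag ≅ F'.diag,
      θ.hom ▷ u ≫ F'.ω.hom = F.ω.hom ∧ F.ν.hom ≫ n ◁ U.map₂ θ.hom = F'.ν.hom := by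
  obtain ⟨σ, ⟨hσ, hσ'⟩, hu⟩ := H.existsUnique_two_cell (𝟙 f) (by simp) F F'
  obtain ⟨τ, ⟨hτ, hτ'⟩, -⟩ := H.existsUnique_two_cell (𝟙 f) (by simp) F' F
  simp only [Category.id_comp] at hσ' hτ' hu
  refine ⟨⟨σ, τ, ?_, ?_⟩, ⟨hσ, hσ'⟩, fun θ hθ => Iso.ext (hu θ.hom hθ)⟩
  · refine (H.existsUnique_two_cell (𝟙 f) (by simp) F F).unique ⟨?_, ?_⟩ ⟨?_, ?_⟩ <;>
      simp [hσ, hτ, reassoc_of% hσ', hτ']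
  · refine (H.existsUnique_two_cell (𝟙 f) (by simp) F' F').unique ⟨?_, ?_⟩ ⟨?_, ?_⟩ <;>
      simp [hσ, hτ, reassoc_of% hτ', hσ']

theorem isGeneric_iff_forall_isGenericAt :
    IsGeneric U n ↔ ∀ ⦃a₂ : A⦄ (v : a ⟶ a₂), IsGenericAt U n v :=
  ⟨fun H _ v => ⟨fun u f α => H.exists_filler u v f α, H.existsUnique_two_cell⟩,
    fun H => ⟨fun u v f α => (H v).exists_filler u f α, (H _).existsUnique_iso,
      (H _).existsUnique_two_cell⟩⟩

/-- The pasting of `U(ω)` with the compositor of `U`, whiskered by `n`. -/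
def pasteIso (U : A ⥤ᵖ B) (n : b ⟶ U.obj a) {w : a ⟶ a₁} {u : a₁ ⟶ a₂} (ω : w ≫ u ≅ v) :
    (n ≫ U.map w) ≫ U.map u ≅ n ≫ U.map v :=
  α_ _ _ _ ≪≫ whiskerLeftIso n (U.mapComp w u).symm ≪≫ whiskerLeftIso n (U.map₂Iso ω)

@[simp]
theorem pasteIso_hom {w : a ⟶ a₁} {u : a₁ ⟶ a₂} (ω : w ≫ u ≅ v) :
    (pasteIso U n ω).hom = (α_ n (U.map w) (U.map u)).hom ≫ n ◁ (U.mapComp w u).inv ≫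
      n ◁ U.map₂ ω.hom := rfl

/-- A triangle in `A` as a filler of its own pasting. -/
def Filler.ofTriangle (U : A ⥤ᵖ B) (n : b ⟶ U.obj a) {w : a ⟶ a₁} {u : a₁ ⟶ a₂} (ω : w ≫ u ≅ v) :
    Filler U n u v (n ≫ U.map w) (pasteIso U n ω) where
  diag := w
  ν := Iso.refl _
  ω := ω
  pasting := by simp

theorem IsGenericAt.existsUnique_map₂ (H : IsGenericAt U n v) {w w' : a ⟶ a₁} {u : a₁ ⟶ a₂}
    {ω : w ≫ u ≅ v} {ω' : w' ≫ u ≅ v} (φ : n ≫ U.map w ⟶ n ≫ U.map w')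
    (hφ : φ ▷ U.map u ≫ (pasteIso U n ω').hom = (pasteIso U n ω).hom) :
    ∃! σ : w ⟶ w', σ ▷ u ≫ ω'.hom = ω.hom ∧ n ◁ U.map₂ σ = φ := by
  simpa [Filler.ofTriangle] using H.existsUnique_two_cell φ hφ (Filler.ofTriangle U n ω)
    (Filler.ofTriangle U n ω')

theorem whiskerRight_comp_pasteIso {w w' : a ⟶ a₁} {u : a₁ ⟶ a₂} {ω : w ≫ u ≅ v}
    {ω' : w' ≫ u ≅ v} {σ : w ⟶ w'} (hσ : σ ▷ u ≫ ω'.hom = ω.hom) :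
    (n ◁ U.map₂ σ) ▷ U.map u ≫ (pasteIso U n ω').hom = (pasteIso U n ω).hom := by
  simp [← hσ]

/-- This is faithfulness of transposition in terms of triangles. -/
theorem IsGenericAt.hom_ext (H : IsGenericAt U n v) {w w' : a ⟶ a₁} {u : a₁ ⟶ a₂}
    {ω : w ≫ u ≅ v} {ω' : w' ≫ u ≅ v} {σ τ : w ⟶ w'} (hσ : σ ▷ u ≫ ω'.hom = ω.hom)
    (hτ : τ ▷ u ≫ ω'.hom = ω.hom) (h : n ◁ U.map₂ σ = n ◁ U.map₂ τ) : σ = τ :=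
  (H.existsUnique_map₂ _ (whiskerRight_comp_pasteIso hσ)).unique ⟨hσ, rfl⟩ ⟨hτ, h.symm⟩

section Triangles

variable {u : a₁ ⟶ a₂} {f : b ⟶ U.obj a₂} {k : b ⟶ U.obj a₁}

/-- Cancelling `κ` passes from the 2-cell condition of the pseudoslice over `f` to the pasting
condition on pseudosquares. -/
theorem whiskerRight_comp_triangle_iff (κ : n ≫ U.map v ≅ f) {w : a ⟶ a₁} (ω : w ≫ u ≅ v)
    (μ : k ⟶ n ≫ U.map w) (α : k ≫ U.map u ≅ n ≫ U.map v) :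
    μ ▷ U.map u ≫ (α_ n (U.map w) (U.map u)).hom ≫
      n ◁ ((U.mapComp w u).inv ≫ U.map₂ ω.hom) ≫ κ.hom = α.hom ≫ κ.hom ↔
    μ ▷ U.map u ≫ (pasteIso U n ω).hom = α.hom := by
  rw [← cancel_mono κ.hom]
  simp

theorem whiskerRight_comp_triangle_eq_triangle_iff (κ : n ≫ U.map v ≅ f) {w w' : a ⟶ a₁}
    (ω : w ≫ u ≅ v) (ω' : w' ≫ u ≅ v) (φ : n ≫ U.map w ⟶ n ≫ U.map w') :
    φ ▷ U.map u ≫ (α_ n (U.map w') (U.map u)).hom ≫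
      n ◁ ((U.mapComp w' u).inv ≫ U.map₂ ω'.hom) ≫ κ.hom =
        (α_ n (U.map w) (U.map u)).hom ≫ n ◁ ((U.mapComp w u).inv ≫ U.map₂ ω.hom) ≫ κ.hom ↔
    φ ▷ U.map u ≫ (pasteIso U n ω').hom = (pasteIso U n ω).hom := by
  rw [← cancel_mono κ.hom]
  simp

theorem Filler.inv_whiskerRight_comp {κ : n ≫ U.map v ≅ f} {χ : k ≫ U.map u ≅ f}
    (F : Filler U n u v k (χ ≪≫ κ.symm)) :
    F.ν.inv ▷ U.map u ≫ χ.hom = (α_ n (U.map F.diag) (U.map u)).hom ≫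
      n ◁ ((U.mapComp F.diag u).inv ≫ U.map₂ F.ω.hom) ≫ κ.hom := by
  have := F.pasting
  rw [Iso.trans_hom, Iso.symm_hom, Iso.eq_comp_inv] at this
  rw [← this]
  simp

theorem Filler.inv_comp_whiskerRight_comp {k' : b ⟶ U.obj a₁} {α : k ≫ U.map u ≅ n ≫ U.map v}
    {α' : k' ≫ U.map u ≅ n ≫ U.map v} {φ : k ⟶ k'} (hφ : φ ▷ U.map u ≫ α'.hom = α.hom)
    (F : Filler U n u v k α) (F' : Filler U n u v k' α') :
    (F.ν.inv ≫ φ ≫ F'.ν.hom) ▷ U.map u ≫ (pasteIso U n F'.ω).hom = (pasteIso U n F.ω).hom := by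
  have h := F.pasting
  rw [← hφ, ← F'.pasting] at h
  simp only [pasteIso_hom, comp_whiskerRight, Category.assoc, ← h, inv_hom_whiskerRight_assoc]

end Triangles

/-- A pseudosquare pasted with `h.iso` is a 1-cell of the pseudoslice; a preimage of it under
transposition is a filler. -/
theorem isGenericAt_of_isBiuniversal {c : PseudoSlice a₂} {d : PseudoSlice (U.obj a₂)}
    {h : d ⟶ (sliceRestriction U a₂).obj c} (H : IsBiuniversal (sliceRestriction U a₂) h) :
    IsGenericAt U (a := c.left) h.left c.hom where
  exists_filler {a₁} u f α := by
    let x : PseudoSlice a₂ := ⟨a₁, u⟩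
    have := H x
    let k : d ⟶ (sliceRestriction U a₂).obj x := ⟨f, α ≪≫ h.iso⟩
    obtain ⟨w, ⟨i⟩⟩ := Functor.EssSurj.mem_essImage (F := transpose _ h x) k
    exact ⟨⟨w.left, PseudoSlice.leftIso i.symm, w.iso,
      (whiskerRight_comp_triangle_iff (a := c.left) h.iso w.iso i.inv.left α).1 i.inv.w⟩⟩
  existsUnique_two_cell {a₁ u f₁ f₂ α₁ α₂} φ hφ F₁ F₂ := by
    let x : PseudoSlice a₂ := ⟨a₁, u⟩
    have := H x
    let w₁ : c ⟶ x := ⟨F₁.diag, F₁.ω⟩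
    let w₂ : c ⟶ x := ⟨F₂.diag, F₂.ω⟩
    let ψ : (transpose _ h x).obj w₁ ⟶ (transpose _ h x).obj w₂ :=
      ⟨F₁.ν.inv ≫ φ ≫ F₂.ν.hom, (whiskerRight_comp_triangle_eq_triangle_iff h.iso F₁.ω F₂.ω _).2
        (F₁.inv_comp_whiskerRight_comp hφ F₂)⟩
    obtain ⟨σ, hσ⟩ := (transpose _ h x).map_surjective ψ
    have hσ' : h.left ◁ U.map₂ σ.left = F₁.ν.inv ≫ φ ≫ F₂.ν.hom :=
      congrArg PseudoSlice.Hom₂.left hσ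
    refine ⟨σ.left, ⟨σ.w, (Iso.eq_inv_comp _).1 hσ'⟩, ?_⟩
    rintro τ ⟨hτ, hτ'⟩
    have : (⟨τ, hτ⟩ : w₁ ⟶ w₂) = σ := (transpose _ h x).map_injective
      (PseudoSlice.hom₂_ext (((Iso.eq_inv_comp _).2 hτ').trans hσ'.symm))
    exact congrArg PseudoSlice.Hom₂.left this

theorem IsGenericAt.isBiuniversal {c : PseudoSlice a₂} {d : PseudoSlice (U.obj a₂)}
    {h : d ⟶ (sliceRestriction U a₂).obj c} (H : IsGenericAt U (a := c.left) h.left c.hom) :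
    IsBiuniversal (sliceRestriction U a₂) h := fun x =>
  { faithful :=
      ⟨fun {w w'} σ τ hστ => PseudoSlice.hom₂_ext
        (H.hom_ext σ.w τ.w (congrArg PseudoSlice.Hom₂.left hστ))⟩
    full := ⟨fun {w w'} φ => by
      obtain ⟨σ, ⟨hσ, hσ'⟩, -⟩ := H.existsUnique_map₂ (ω := w.iso) (ω' := w'.iso) φ.left
        ((whiskerRight_comp_triangle_eq_triangle_iff h.iso w.iso w'.iso _).1 φ.w)
      exact ⟨⟨σ, hσ⟩, PseudoSlice.hom₂_ext hσ'⟩⟩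
    essSurj := ⟨fun k => by
      obtain ⟨F⟩ := H.exists_filler x.hom k.left (k.iso ≪≫ h.iso.symm)
      let w : c ⟶ x := ⟨F.diag, F.ω⟩
      exact ⟨w, ⟨PseudoSlice.mkIso F.ν.symm
        (Filler.inv_whiskerRight_comp (κ := h.iso) (χ := k.iso) F)⟩⟩⟩ }

end Generic

/-! ### Changing the bottom side, and the theorem -/

section Generic

variable {A : Type u₁} [Bicategory.{w₁, v₁} A] {B : Type u₂} [Bicategory.{w₂, v₂} B]

variable {U : A ⥤ᵖ B} {b : B} {a a' a₁ a₂ : A} {n : b ⟶ U.obj a}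

theorem mapComp_inv_comp_map₂_associator_inv (U : A ⥤ᵖ B) {x y z t : A} (s : x ⟶ y) (u : y ⟶ z)
    (v : z ⟶ t) :
    (U.mapComp s (u ≫ v)).inv ≫ U.map₂ (α_ s u v).inv ≫ (U.mapComp (s ≫ u) v).hom =
      U.map s ◁ (U.mapComp u v).hom ≫ (α_ _ _ _).inv ≫ (U.mapComp s u).inv ▷ U.map v := by
  have := U.mapComp_assoc_left_inv s u v
  rw [← Category.assoc, ← Iso.eq_comp_inv]
  simp [this]

section Extension

variable {w : a ⟶ a'} {v : a' ⟶ a₂} {v₀ : a ⟶ a₂} {u : a₁ ⟶ a'} {f : b ⟶ U.obj a₁}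

/-- A pseudosquare over `w`, extended along a triangle `w ≫ v ≅ v₀`. -/
def extendSquare (ω₀ : w ≫ v ≅ v₀) (α : f ≫ U.map u ≅ n ≫ U.map w) :
    f ≫ U.map (u ≫ v) ≅ n ≫ U.map v₀ :=
  whiskerLeftIso f (U.mapComp u v) ≪≫ (α_ _ _ _).symm ≪≫ whiskerRightIso α (U.map v) ≪≫
    pasteIso U n ω₀

/-- A filler of a pseudosquare over `w` fills the extended pseudosquare. -/
def Filler.extend (ω₀ : w ≫ v ≅ v₀) {α : f ≫ U.map u ≅ n ≫ U.map w} (F : Filler U n u w f α) :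
    Filler U n (u ≫ v) v₀ f (extendSquare ω₀ α) where
  diag := F.diag
  ν := F.ν
  ω := (α_ _ _ _).symm ≪≫ whiskerRightIso F.ω v ≪≫ ω₀
  pasting := by
    have key := congrArg (n ◁ ·) (mapComp_inv_comp_map₂_associator_inv U F.diag u v)
    simp only [whiskerLeft_comp] at key
    have hF := F.pasting
    simp only [extendSquare, ← hF, Iso.trans_hom, whiskerLeftIso_hom, Iso.symm_hom,
      whiskerRightIso_hom, pasteIso_hom, Category.assoc, PrelaxFunctor.map₂_comp,
      U.map₂_whisker_right, whiskerLeft_comp, comp_whiskerRight, reassoc_of% key]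
    rw [← associator_naturality_right_assoc, ← whisker_exchange_assoc]
    simp

theorem whiskerRight_comp_extendSquare (ω₀ : w ≫ v ≅ v₀) {f' : b ⟶ U.obj a₁}
    {α : f ≫ U.map u ≅ n ≫ U.map w} {α' : f' ≫ U.map u ≅ n ≫ U.map w} {φ : f ⟶ f'}
    (hφ : φ ▷ U.map u ≫ α'.hom = α.hom) :
    φ ▷ U.map (u ≫ v) ≫ (extendSquare ω₀ α').hom = (extendSquare ω₀ α).hom := by
  simp only [extendSquare, Iso.trans_hom, whiskerLeftIso_hom, Iso.symm_hom, whiskerRightIso_hom,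
    ← hφ, comp_whiskerRight, Category.assoc]
  rw [← whisker_exchange_assoc, associator_inv_naturality_left_assoc]

/-- A square over `w` extends along `ω₀` to one over `v₀`. Its filler has a lower triangle only
after composing with `v`; uniqueness of fillers against `U(v)` removes that `v`. -/
theorem IsGenericAt.of_comp (H : IsGenericAt U n v₀) (ω₀ : w ≫ v ≅ v₀) : IsGenericAt U n w where
  exists_filler {a₁} u f α := by
    obtain ⟨F⟩ := H.exists_filler (u ≫ v) f (extendSquare ω₀ α)
    let φ : n ≫ U.map (F.diag ≫ u) ≅ n ≫ U.map w := whiskerLeftIso n (U.mapComp F.diag u) ≪≫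
      (α_ _ _ _).symm ≪≫ whiskerRightIso F.ν.symm (U.map u) ≪≫ α
    have hφ : φ.hom ▷ U.map v ≫ (pasteIso U n ω₀).hom =
        (pasteIso U n (α_ F.diag u v ≪≫ F.ω)).hom := by
      have hF := F.pasting
      simp only [extendSquare, Iso.trans_hom, whiskerLeftIso_hom, Iso.symm_hom,
        whiskerRightIso_hom] at hF
      replace hF := (α_ f (U.map u) (U.map v)).hom ≫= f ◁ (U.mapComp u v).inv ≫= hF
      simp only [whiskerLeft_inv_hom_assoc, Iso.hom_inv_id_assoc] at hF
      simp only [φ, Iso.trans_hom, whiskerLeftIso_hom, Iso.symm_hom, whiskerRightIso_hom,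
        comp_whiskerRight, Category.assoc, ← hF]
      rw [whisker_exchange_assoc, associator_naturality_right_assoc]
      simp
    -- Both `w` and `F.diag ≫ u` are diagonals of this square, so they are isomorphic; the
    -- isomorphism is the missing lower triangle.
    let G : Filler U n v v₀ (n ≫ U.map (F.diag ≫ u)) (pasteIso U n (α_ F.diag u v ≪≫ F.ω)) :=
      ⟨w, φ, ω₀, hφ⟩
    obtain ⟨θ, hθ⟩ : ∃ θ : F.diag ≫ u ≅ w, n ◁ U.map₂ θ.hom = φ.hom := by
      obtain ⟨θ, ⟨-, hθ⟩, -⟩ :=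
        H.existsUnique_iso (Filler.ofTriangle U n (α_ F.diag u v ≪≫ F.ω)) G
      exact ⟨θ, (Category.id_comp _).symm.trans hθ⟩
    refine ⟨⟨F.diag, F.ν, θ, ?_⟩⟩
    rw [hθ]
    simp [φ]
  existsUnique_two_cell {a₁ u f₁ f₂ α₁ α₂} φ hφ F₁ F₂ := by
    have key : ∃! σ : F₁.diag ⟶ F₂.diag,
        σ ▷ (u ≫ v) ≫ (α_ _ _ _).inv ≫ F₂.ω.hom ▷ v ≫ ω₀.hom =
          (α_ _ _ _).inv ≫ F₁.ω.hom ▷ v ≫ ω₀.hom ∧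
        F₁.ν.hom ≫ n ◁ U.map₂ σ = φ ≫ F₂.ν.hom :=
      H.existsUnique_two_cell φ (whiskerRight_comp_extendSquare ω₀ hφ) (F₁.extend ω₀)
        (F₂.extend ω₀)
    obtain ⟨σ, ⟨hσ, hσ'⟩, hu⟩ := key
    refine ⟨σ, ⟨?_, hσ'⟩, fun τ hτ => hu τ ⟨?_, hτ.2⟩⟩
    -- The two 2-cells `F₁.diag ≫ u ⟶ w` are compared as 2-cells over `v`, where genericity at `v₀`
    -- applies.
    · refine H.hom_ext (ω := whiskerRightIso F₁.ω v ≪≫ ω₀) (ω' := ω₀) ?_ ?_ ?_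
      · rw [associator_inv_naturality_left_assoc, cancel_epi] at hσ
        simpa using hσ
      · simp
      · have h := F₁.pasting
        rw [← hφ, ← F₂.pasting, ← comp_whiskerRight_assoc] at h
        rw [← hσ'] at h
        rw [← cancel_epi (n ◁ (U.mapComp F₁.diag u).inv),
          ← cancel_epi (α_ n (U.map F₁.diag) (U.map u)).hom,
          ← cancel_epi (F₁.ν.hom ▷ U.map u)]
        simpa using h.symm
    · simp [← hτ.1]

end Extension

/-- Over `n`, both `h` (via `κ`) and `n` (via the unitors) are biuniversal, and `w` underlies a lift
of the identity between them. -/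
theorem isEquivalence₁_of_isGenericAt {h : b ⟶ U.obj a'} {w : a' ⟶ a} (Hh : IsGenericAt U h w)
    (Hn : IsGenericAt U n (𝟙 a)) (κ : h ≫ U.map w ≅ n) : IsEquivalence₁ w := by
  let d : PseudoSlice (U.obj a) := ⟨b, n⟩
  let x : PseudoSlice a := ⟨a', w⟩
  let y : PseudoSlice a := ⟨a, 𝟙 a⟩
  let h₁ : d ⟶ (sliceRestriction U a).obj x := ⟨h, κ⟩
  let n₁ : d ⟶ (sliceRestriction U a).obj y := ⟨n, whiskerLeftIso n (U.mapId a) ≪≫ ρ_ n⟩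
  let l : Lift (sliceRestriction U a) h₁ n₁ (𝟙 d) := ⟨⟨w, ρ_ w⟩,
    PseudoSlice.mkIso (λ_ n ≪≫ κ.symm) (by
    change ((λ_ n).hom ≫ κ.inv) ▷ U.map (𝟙 a) ≫ (α_ _ _ _).hom ≫
      h ◁ ((U.mapComp w (𝟙 a)).inv ≫ U.map₂ (ρ_ w).hom) ≫ κ.hom =
      (α_ _ _ _).hom ≫ 𝟙 b ◁ (n ◁ (U.mapId a).hom ≫ (ρ_ n).hom) ≫ (λ_ n).hom
    simp only [U.map₂_right_unitor, whiskerLeft_comp, Iso.inv_hom_id_assoc, comp_whiskerRight,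
      Category.assoc]
    rw [← associator_naturality_right_assoc, ← whisker_exchange_assoc, ← whisker_exchange_assoc,
      ← associator_naturality_right_assoc]
    simp)⟩
  exact (IsBiuniversal.isEquivalence₁_lift (IsGenericAt.isBiuniversal (h := h₁) Hh)
    (IsGenericAt.isBiuniversal (h := n₁) Hn) l).left

theorem IsGenericAt.of_isEquivalence₁ {h : b ⟶ U.obj a'} {w : a' ⟶ a} {v : a ⟶ a₂} {v₀ : a' ⟶ a₂}
    (H : IsGenericAt U h v₀) (hw : IsEquivalence₁ w) (κ : h ≫ U.map w ≅ n) (ω : w ≫ v ≅ v₀) :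
    IsGenericAt U n v := by
  let d : PseudoSlice (U.obj a₂) := ⟨b, n ≫ U.map v⟩
  let x : PseudoSlice a₂ := ⟨a', v₀⟩
  let y : PseudoSlice a₂ := ⟨a, v⟩
  let h₁ : d ⟶ (sliceRestriction U a₂).obj x :=
    ⟨h, (pasteIso U h ω).symm ≪≫ whiskerRightIso κ (U.map v)⟩
  let n₁ : d ⟶ (sliceRestriction U a₂).obj y := ⟨n, Iso.refl _⟩
  let e : x ⟶ y := ⟨w, ω⟩
  refine isGenericAt_of_isBiuniversal (h := n₁)
    ((IsGenericAt.isBiuniversal (h := h₁) H).of_isEquivalence₁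
    (IsEquivalence₁.of_left (e := e) hw) (PseudoSlice.mkIso κ ?_))
  change κ.hom ▷ U.map v ≫ 𝟙 _ = (α_ _ _ _).hom ≫ h ◁ ((U.mapComp w v).inv ≫ U.map₂ ω.hom) ≫
    (pasteIso U h ω).inv ≫ κ.hom ▷ U.map v
  rw [Category.comp_id, whiskerLeft_comp_assoc]
  have := (pasteIso U h ω).hom_inv_id_assoc (κ.hom ▷ U.map v)
  simpa using this.symm

/-- The unit at `n ≫ U.map v` is generic at a composite of `l.map.left` with `v`, hence at
`l.map.left`, while `n` is generic at the identity. So `l.map.left` is an equivalence, carrying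
genericity at `v` to `n`. -/
theorem IsGenericAt.isGeneric {v₀ : a ⟶ a₁} (H : IsGenericAt U n v₀)
    (hU : IsLocalRightBiadjoint U) : IsGeneric U n := by
  rw [isGeneric_iff_forall_isGenericAt]
  intro a₂ v
  obtain ⟨Λ⟩ := hU a₂
  let d : PseudoSlice (U.obj a₂) := ⟨b, n ≫ U.map v⟩
  let n₁ : d ⟶ (sliceRestriction U a₂).obj ⟨a, v⟩ := ⟨n, Iso.refl _⟩
  have Hh : IsBiuniversal (sliceRestriction U a₂) (c := Λ.L.obj d) (Λ.unit.app d) :=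
    Λ.isEquivalence_transpose d
  obtain ⟨l⟩ := Hh.nonempty_lift n₁ (𝟙 d)
  have Hh' := isGenericAt_of_isBiuniversal Hh
  let κ : (Λ.unit.app d).left ≫ U.map l.map.left ≅ n :=
    PseudoSlice.leftIso l.iso.symm ≪≫ λ_ n
  exact Hh'.of_isEquivalence₁ (isEquivalence₁_of_isGenericAt (Hh'.of_comp l.map.iso)
    (H.of_comp (λ_ v₀)) κ) κ l.map.iso

theorem LeftBiadjoint.isGenericAt_unit (Λ : LeftBiadjoint (sliceRestriction U a))
    (f : PseudoSlice (U.obj a)) :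
    IsGenericAt U (a := (Λ.L.obj f).left) (Λ.unit.app f).left (Λ.L.obj f).hom :=
  isGenericAt_of_isBiuniversal (Λ.isEquivalence_transpose f)

theorem LeftBiadjoint.isGeneric_unit (Λ : LeftBiadjoint (sliceRestriction U a))
    (hU : IsLocalRightBiadjoint U) (f : PseudoSlice (U.obj a)) :
    IsGeneric U (a := (Λ.L.obj f).left) (Λ.unit.app f).left :=
  (Λ.isGenericAt_unit f).isGeneric hU

theorem LeftBiadjoint.isGeneric_iff (Λ : LeftBiadjoint (sliceRestriction U a))
    (hU : IsLocalRightBiadjoint U) :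
    IsGeneric U n ↔ IsEquivalence₁ (Λ.L.obj ⟨b, n⟩).hom := by
  refine ⟨fun H => ?_, fun H => ?_⟩
  · exact isEquivalence₁_of_isGenericAt (Λ.isGenericAt_unit ⟨b, n⟩)
      (isGeneric_iff_forall_isGenericAt.1 H (𝟙 a)) (Λ.unit.app ⟨b, n⟩).iso
  · exact isGeneric_iff_forall_isGenericAt.2 fun a₂ v =>
      (isGeneric_iff_forall_isGenericAt.1 (Λ.isGeneric_unit hU ⟨b, n⟩) _).of_isEquivalence₁ H
        (Λ.unit.app ⟨b, n⟩).iso (Iso.refl _)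

theorem exists_leftBiadjoint (F : ∀ f : PseudoSlice (U.obj a), GenericFactorization U f.hom) :
    ∃ Λ : LeftBiadjoint (sliceRestriction U a), ∀ f : PseudoSlice (U.obj a),
      (⟨Λ.L.obj f, Λ.unit.app f⟩ :
        Σ u : PseudoSlice a, f ⟶ (sliceRestriction U a).obj u) =
      ⟨⟨(F f).mid, (F f).right⟩, ⟨(F f).left, (F f).iso⟩⟩ := by
  let h : ∀ f : PseudoSlice (U.obj a),
    f ⟶ (sliceRestriction U a).obj ⟨(F f).mid, (F f).right⟩ := fun f => ⟨(F f).left, (F f).iso⟩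
  have H : ∀ f, IsBiuniversal (sliceRestriction U a) (h f) := fun f =>
    IsGenericAt.isBiuniversal (h := h f) (isGeneric_iff_forall_isGenericAt.1 (F f).generic _)
  -- The construction keeps the chosen objects and 1-cells on the nose.
  exact ⟨leftBiadjointOfBiuniversal H, fun f => rfl⟩

theorem IsBistable.isLocalRightBiadjoint (hU : IsBistable U) : IsLocalRightBiadjoint U := fun _ =>
  ⟨(exists_leftBiadjoint fun f => (hU f.hom).choose).choose⟩

/-- A comparison of generic factorizations is a filler of the square formed by them. -/
def Comparison.filler {f : b ⟶ U.obj a} {G F : GenericFactorization U f} (c : Comparison U G F) :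
    Filler U G.left F.right G.right F.left (F.iso ≪≫ G.iso.symm) where
  diag := c.e
  ν := c.ν.symm
  ω := c.ω
  pasting := by
    rw [Iso.trans_hom, Iso.symm_hom G.iso, Iso.eq_comp_inv, ← c.pasting]
    simp only [Category.assoc]
    rw [← whiskerLeft_comp_assoc _ (U.map₂ c.ω.hom), ← PrelaxFunctor.map₂_comp]
    simp

/-- The diagonal of a filler is an equivalence because `G.left` is generic at it and `F.left` at the
identity. -/
theorem nonempty_comparison {f : b ⟶ U.obj a} (G F : GenericFactorization U f) :
    Nonempty (Comparison U G F) := by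
  obtain ⟨K⟩ := G.generic.exists_filler F.right G.right F.left (F.iso ≪≫ G.iso.symm)
  refine ⟨⟨K.diag, ?_, K.ν.symm, K.ω, ?_⟩⟩
  · exact isEquivalence₁_of_isGenericAt
      (isGeneric_iff_forall_isGenericAt.1 G.generic _)
      (isGeneric_iff_forall_isGenericAt.1 F.generic _) K.ν.symm
  · have := K.pasting
    rw [Iso.trans_hom, Iso.symm_hom, Iso.eq_comp_inv] at this
    rw [← this]
    simp only [Iso.symm_hom, Category.assoc, inv_hom_whiskerRight_assoc, Iso.inv_hom_id_assoc,
      whiskerLeft_hom_inv_assoc]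
    rw [← whiskerLeft_comp_assoc, ← PrelaxFunctor.map₂_comp]
    simp

theorem Comparison.existsUnique_iso {f : b ⟶ U.obj a} {G F : GenericFactorization U f}
    (c c' : Comparison U G F) : ∃! θ : c.e ≅ c'.e,
      θ.hom ▷ F.right ≫ c'.ω.hom = c.ω.hom ∧ G.left ◁ U.map₂ θ.hom ≫ c'.ν.hom = c.ν.hom := by
  have : ∃! θ : c.e ≅ c'.e,
      θ.hom ▷ F.right ≫ c'.ω.hom = c.ω.hom ∧ c.ν.inv ≫ G.left ◁ U.map₂ θ.hom = c'.ν.inv :=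
    G.generic.existsUnique_iso c.filler c'.filler
  simpa only [Iso.inv_comp_eq, Iso.eq_comp_inv] using this

theorem IsLocalRightBiadjoint.isBistable (hU : IsLocalRightBiadjoint U) : IsBistable U := by
  intro b a f
  obtain ⟨Λ⟩ := hU a
  exact ⟨⟨(Λ.L.obj ⟨b, f⟩).left, (Λ.unit.app ⟨b, f⟩).left, (Λ.L.obj ⟨b, f⟩).hom,
    (Λ.unit.app ⟨b, f⟩).iso, Λ.isGeneric_unit hU ⟨b, f⟩⟩,
    fun G => ⟨nonempty_comparison G _, Comparison.existsUnique_iso⟩⟩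

theorem IsLocalUnit.isGeneric (hU : IsLocalRightBiadjoint U) (hn : IsLocalUnit U n) :
    IsGeneric U n := by
  obtain ⟨a₀, Λ, f, h⟩ := hn
  -- Generalizing over the pair lets the equality of dependent pairs be eliminated.
  have key : ∀ p : Σ a' : A, b ⟶ U.obj a',
      (⟨(Λ.L.obj ⟨b, f⟩).left, (Λ.unit.app ⟨b, f⟩).left⟩ : Σ a' : A, b ⟶ U.obj a') = p →
        IsGeneric U p.2 := by
    rintro _ rfl
    exact Λ.isGeneric_unit hU ⟨b, f⟩
  exact key _ h

theorem IsGeneric.isLocalUnit (hU : IsBistable U) (hn : IsGeneric U n) : IsLocalUnit U n := by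
  classical
  let G : GenericFactorization U n := ⟨a, n, 𝟙 a, whiskerLeftIso n (U.mapId a) ≪≫ ρ_ n, hn⟩
  let F : ∀ f : PseudoSlice (U.obj a), GenericFactorization U f.hom :=
    -- Being a local unit demands a strict equality, so at `n` the chosen factorization is replaced
    -- by the trivial one, with left part `n` itself.
    Function.update (fun f => (hU f.hom).choose) ⟨b, n⟩ G
  obtain ⟨Λ, hΛ⟩ := exists_leftBiadjoint F
  refine ⟨a, Λ, n, ?_⟩
  have h := hΛ ⟨b, n⟩
  have hF : F ⟨b, n⟩ = G := Function.update_self _ _ _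
  rw [hF] at h
  exact congrArg (fun p : Σ u : PseudoSlice a,
    (⟨b, n⟩ : PseudoSlice (U.obj a)) ⟶ (sliceRestriction U a).obj u =>
      (⟨p.1.left, p.2.left⟩ : Σ a' : A, b ⟶ U.obj a')) h

end Generic

end TwoDimStability

open TwoDimStability in
theorem mainTheorem2 {A : Type u₁} [Bicategory.{w₁, v₁} A] {B : Type u₂} [Bicategory.{w₂, v₂} B]
    (U : A ⥤ᵖ B) :
    (IsBistable U ↔ IsLocalRightBiadjoint U) ∧
    -- the local units are exactly the generic 1-cells
    (IsBistable U → ∀ ⦃b : B⦄ ⦃a : A⦄ (n : b ⟶ U.obj a), IsGeneric U n ↔ IsLocalUnit U n) ∧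
    -- for any choice of local left biadjoints, the unit components are generic, and the generic
    -- 1-cells are those sent to equivalences
    (∀ Λ : ∀ a : A, LeftBiadjoint (sliceRestriction U a),
      (∀ (a : A) (f : PseudoSlice (U.obj a)),
        IsGeneric U (a := ((Λ a).L.obj f).left) ((Λ a).unit.app f).left) ∧
      ∀ ⦃b : B⦄ ⦃a : A⦄ (n : b ⟶ U.obj a),
        IsGeneric U n ↔ IsEquivalence₁ ((Λ a).L.obj ⟨b, n⟩).hom) ∧
    -- any choice of generic factorizations over `a` is the unit of a local left biadjoint at `a`
    (∀ (a : A) (F : ∀ f : PseudoSlice (U.obj a), GenericFactorization U f.hom),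
      ∃ Λ : LeftBiadjoint (sliceRestriction U a), ∀ f : PseudoSlice (U.obj a),
        (⟨Λ.L.obj f, Λ.unit.app f⟩ :
          Σ u : PseudoSlice a, f ⟶ (sliceRestriction U a).obj u) =
        ⟨⟨(F f).mid, (F f).right⟩, ⟨(F f).left, (F f).iso⟩⟩) := by
  refine ⟨⟨IsBistable.isLocalRightBiadjoint, IsLocalRightBiadjoint.isBistable⟩, ?_, ?_, ?_⟩
  · exact fun hU b a n => ⟨fun hn => hn.isLocalUnit hU,
      fun hn => hn.isGeneric hU.isLocalRightBiadjoint⟩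
  · intro Λ
    have hU : IsLocalRightBiadjoint U := fun a => ⟨Λ a⟩
    exact ⟨fun a f => (Λ a).isGeneric_unit hU f, fun b a n => (Λ a).isGeneric_iff hU⟩
  · exact fun a F => exists_leftBiadjoint F
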